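/- Let $1\le n$, $0\le k\le n$, $0<c_1<1$, $0<\kappa\le 1$, and let $E\subset\mathbb R^n$ be a convex body (compact, convex, with non-empty interior), with width $w(E)$ (the minimal distance of two parallel supporting hyperplanes). For an oriented $k$-rectifiable $\mathcal H^k$-measurable set $S\subset E$ with $0<\mathcal H^k(S)<\infty$ and orientation $\tau$, let $T_S(\omega)=\frac{1}{\mathcal H^k(S)}\int_S\langle\omega;\tau\rangle\,d\mathcal H^k$ for continuous $k$-forms $\omega$ on $E$, and let $\|\omega\|_0=\sup_S|T_S(\omega)|$. An integral $k$-mesh for $E$ is a sequence $(\mathcal T^{(r)})_{r\ge 1}$ of finite sets of such functionals $T_S$, where each $S\subset E$ has the form $x+A\Omega$ with $x\in E$, $A\in\mathbb R^{n\times k}$ of rank $k$, $\Omega\subset\mathbb R^k$ Lebesgue measurable with $0<\mathcal L^k(\Omega)<\infty$, oriented by the normalized wedge product of the columns of $A$. Put $\|\omega\|_{\mathcal T^{(r)}}=\max_{T\in\mathcal T^{(r)}}|T(\omega)|$, and let $\mathcal P_r\Lambda^k(E)$ be the space of $k$-forms on $E$ with polynomial coefficients of total degree at most $r$. The mesh is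 $\{\mathcal P_r\Lambda^k(E)\}$-admissible if $\limsup_{r\to\infty}(\operatorname{Card}\mathcal T^{(r)})^{1/r}\le 1$ and $\sup_r\sup\{\|\omega\|_0/\|\omega\|_{\mathcal T^{(r)}}:\omega\in\mathcal P_r\Lambda^k(E)\setminus\{0\}\}<\infty$. For every $r\ge 1$ set $$d_r=\frac{c_1\,w(E)}{4\sqrt n\,\binom nk\,r^2},$$ choose a coordinate box $Q\supset E$ and a finite tessellation $\{Q_i\}$ of $Q$ by closed coordinate cubes with sides in $[\kappa d_r,d_r]$ and pairwise disjoint interiors. For each $i$ with $Q_i\cap\operatorname{int}E\ne\emptyset$ pick a point $\tilde x_i\in Q_i\cap\operatorname{int}E$, and for each increasing multi-index $\alpha$ of length $k$ pick $0<\epsilon_{i,\alpha}\le\min(\operatorname{dist}(\tilde x_i,\partial E),\operatorname{dist}(\tilde x_i,\partial Q_i))$. Let $\mathcal T^{(r)}$ be the set of all functionals $T_S$ with $S=\tilde x_i+P^\alpha(\epsilon_{i,\alpha}\Sigma_k)$, where $P^\alpha$ is the matrix with columns $e_{\alpha(1)},\dots,e_{\alpha(k)}$ and $\Sigma_k=\{y\in\mathbb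 R^k:y_i\ge0,\ \sum_i y_i\le1\}$. Such choices exist for every $r$, and for all such choices $(\mathcal T^{(r)})_{r\ge 1}$ is a $\{\mathcal P_r\Lambda^k(E)\}$-admissible integral $k$-mesh for $E$ with $$\|\omega\|_0\le\frac{\sqrt{\binom nk}}{1-c_1}\,\|\omega\|_{\mathcal T^{(r)}}\qquad\text{for all } r\ge1 \text{ and } \omega\in\mathcal P_r\Lambda^k(E).$$ Moreover $\operatorname{Card}\mathcal T^{(r)}\le K\left(\frac{\operatorname{diam}E}{w(E)}\right)^n r^{2n}$ for all $r\ge1$, with a constant $K$ that depends only on $n,k,c_1,\kappa$; in particular $\operatorname{Card}\mathcal T^{(r)}=\mathcal O(r^{2n})$. -/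

import Mathlib

open MeasureTheory Filter Topology
open scoped ENNReal

namespace FormMesh

noncomputable section

/-- Euclidean space `ℝⁿ`. -/
abbrev Vec (n : ℕ) : Type := EuclideanSpace ℝ (Fin n)

/-- Increasing multi-indices `α : {1, …, k} → {1, …, n}`. -/
abbrev MultiIdx (n k : ℕ) : Type := Fin k ↪o Fin n

/-- The space `Λ_k` of `k`-vectors of `ℝⁿ`, written in coordinates with respect to the basis
`e_α = e_{α(1)} ∧ … ∧ e_{α(k)}`, `α` increasing. This basis is orthonormal for the Euclidean
structure of `Λ_k`. -/
abbrev KVec (n k : ℕ) : Type := EuclideanSpace ℝ (MultiIdx n k)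

/-- The space `Λ^k` of `k`-covectors of `ℝⁿ`. -/
abbrev KCovec (n k : ℕ) : Type := Vec n [⋀^Fin k]→L[ℝ] ℝ

variable {n k : ℕ}

/-- The simple `k`-vector `v₁ ∧ … ∧ v_k`: its `e_α`-coordinate is the minor of rows `α` of the
matrix with columns `v₁, …, v_k`. -/
def wedge (v : Fin k → Vec n) : KVec n k :=
  WithLp.toLp 2 fun α => (Matrix.of fun i j : Fin k => v j (α i)).det

/-- The value of a covector on the basis `k`-vector `e_α`. -/
def coeff (η : KCovec n k) (α : MultiIdx n k) : ℝ :=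
  η fun i => EuclideanSpace.single (α i) (1 : ℝ)

/-- The dual pairing `⟨η; τ⟩` of `Λ^k` and `Λ_k`. -/
def pairing (η : KCovec n k) (τ : KVec n k) : ℝ := ∑ α, τ α * coeff η α

/-! ### Rectifiable sets and orientations -/

/-- Near `x`, the set `N` is an embedded `C¹` submanifold of `ℝⁿ` of dimension `k`
(a regular level set of a `C¹` map to `ℝ^(n-k)`), and its tangent space at `x` is `W`. -/
def IsC1SubmanifoldAt (k : ℕ) (N : Set (Vec n)) (x : Vec n) (W : Submodule ℝ (Vec n)) : Prop :=
  ∃ (m : ℕ) (f : Vec n → Vec m) (U : Set (Vec n)), m + k = n ∧ IsOpen U ∧ x ∈ U ∧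
    ContDiffOn ℝ 1 f U ∧ (∀ y ∈ U, Function.Surjective (fderiv ℝ f y)) ∧
    N ∩ U = {y ∈ U | f y = 0} ∧ W = LinearMap.ker (fderiv ℝ f x : Vec n →ₗ[ℝ] Vec m)

/-- `N` is an embedded `C¹` submanifold of `ℝⁿ` of dimension `k`. -/
def IsC1Submanifold (k : ℕ) (N : Set (Vec n)) : Prop :=
  ∀ x ∈ N, ∃ W, IsC1SubmanifoldAt k N x W

/-- `τ` is a unit simple `k`-vector whose factors form a basis of the `k`-dimensional space `W`.
(The sign only matters for `k = 0`, where the orientations of a point are `1` and `-1`.) -/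
def IsUnitSimpleIn (τ : KVec n k) (W : Submodule ℝ (Vec n)) : Prop :=
  ‖τ‖ = 1 ∧ ∃ v : Fin k → Vec n, (τ = wedge v ∨ τ = -wedge v) ∧
    LinearIndependent ℝ v ∧ Submodule.span ℝ (Set.range v) = W

/-- `S` is `k`-rectifiable: up to an `ℋ^k`-null set, it is covered by countably many Lipschitz
images of `ℝ^k`. -/
def IsRectifiable (k : ℕ) (S : Set (Vec n)) : Prop :=
  ∃ (Z : Set (Vec n)) (f : ℕ → Vec k → Vec n), μHE[k] Z = 0 ∧
    (∀ i, ∃ L, LipschitzWith L (f i)) ∧ S ⊆ Z ∪ ⋃ i, Set.range (f i)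

/-- `τ` is an orientation of `S`: there is a decomposition `S = S_reg ∪ S_sing` into disjoint
sets, with `S_sing` an `ℋ^k`-null set and `S_reg` a countable disjoint union of measurable pieces
of `C¹` embedded `k`-dimensional submanifolds, such that `τ` is continuous on `S_reg` and is, at
each point of `S_reg`, a unit simple `k`-vector spanning the tangent space. -/
def IsOrientation (S : Set (Vec n)) (τ : Vec n → KVec n k) : Prop :=
  ∃ (N P : ℕ → Set (Vec n)) (Z : Set (Vec n)),
    S = (⋃ i, P i) ∪ Z ∧ Disjoint (⋃ i, P i) Z ∧ μHE[k] Z = 0 ∧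
    Pairwise (fun i j => Disjoint (P i) (P j)) ∧
    (∀ i, IsC1Submanifold k (N i) ∧ P i ⊆ N i ∧ NullMeasurableSet (P i) μHE[k]) ∧
    (∀ i, ∀ x ∈ P i, ∃ W, IsC1SubmanifoldAt k (N i) x W ∧ IsUnitSimpleIn (τ x) W) ∧
    ContinuousOn τ (⋃ i, P i)

/-! ### Test forms, averaging currents and the norm -/

/-- Test forms: continuous `k`-forms on `E`. -/
abbrev TestForm (E : Set (Vec n)) (k : ℕ) : Type := C(E, KCovec n k)

open Classical in
/-- A test form on `E`, extended by `0` outside `E` (only its values on `E` are ever used). -/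
def extendZero {E : Set (Vec n)} (ω : TestForm E k) (x : Vec n) : KCovec n k :=
  if h : x ∈ E then ω ⟨x, h⟩ else 0

/-- The functional `T_S : ω ↦ ℋ^k(S)⁻¹ ∫_S ⟨ω(x); τ(x)⟩ dℋ^k(x)`. -/
def average (E S : Set (Vec n)) (τ : Vec n → KVec n k) (ω : TestForm E k) : ℝ :=
  (μHE[k] S).toReal⁻¹ * ∫ x in S, pairing (extendZero ω x) (τ x) ∂μHE[k]

/-- The class `𝒜^k(E)` of currents of integral averaging: the functionals `T_S`, for `S ⊆ E` an
`ℋ^k`-measurable oriented `k`-rectifiable set of finite positive measure. -/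
def averagingCurrents (E : Set (Vec n)) (k : ℕ) : Set (TestForm E k → ℝ) :=
  {T | ∃ (S : Set (Vec n)) (τ : Vec n → KVec n k), S ⊆ E ∧ NullMeasurableSet S μHE[k] ∧
    0 < μHE[k] S ∧ μHE[k] S < ∞ ∧ IsRectifiable k S ∧ IsOrientation S τ ∧ T = average E S τ}

/-- The seminorm `ω ↦ sup_{T ∈ 𝒯} |T(ω)|`. -/
def seminormOn {E : Set (Vec n)} (𝒯 : Set (TestForm E k → ℝ)) (ω : TestForm E k) : ℝ≥0∞ :=
  ⨆ T ∈ 𝒯, ENNReal.ofReal |T ω|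

/-- `‖ω‖₀`, the supremum of `ℋ^k(S)⁻¹ |∫_S ω|` over the oriented `k`-rectifiable `S ⊆ E`. -/
def zeroNorm {E : Set (Vec n)} (ω : TestForm E k) : ℝ≥0∞ :=
  seminormOn (averagingCurrents E k) ω

/-! ### Integral meshes -/

/-- The flat piece `{x + A y : y ∈ Ω}`. -/
def flatPiece (x : Vec n) (A : Matrix (Fin n) (Fin k) ℝ) (Ω : Set (Vec k)) : Set (Vec n) :=
  (fun y => x + WithLp.toLp 2 (A.mulVec y.ofLp)) '' Ω

/-- The unit `k`-vector `A_{:,1} ∧ … ∧ A_{:,k} / |A_{:,1} ∧ … ∧ A_{:,k}|`. -/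
def flatOrientation (A : Matrix (Fin n) (Fin k) ℝ) : KVec n k :=
  ‖wedge fun l => WithLp.toLp 2 (A.col l)‖⁻¹ • wedge fun l => WithLp.toLp 2 (A.col l)

/-- The averaging functional on the flat piece `x + A Ω` oriented by the columns of `A`. -/
def flatAverage (E : Set (Vec n)) (x : Vec n) (A : Matrix (Fin n) (Fin k) ℝ) (Ω : Set (Vec k)) :
    TestForm E k → ℝ :=
  average E (flatPiece x A Ω) fun _ => flatOrientation A

/-- Integral `k`-meshes for `E`: sequences, indexed by `r = 1, 2, …`, of finite sets of averaging
currents that are carried by pieces of `k`-dimensional affine spaces contained in `E`. -/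
def IsIntegralMesh (E : Set (Vec n)) (k : ℕ) (𝒯 : ℕ+ → Set (TestForm E k → ℝ)) : Prop :=
  ∀ r, (𝒯 r).Finite ∧ 𝒯 r ⊆ averagingCurrents E k ∧
    ∀ T ∈ 𝒯 r, ∃ (x : Vec n) (A : Matrix (Fin n) (Fin k) ℝ) (Ω : Set (Vec k)),
      x ∈ E ∧ A.rank = k ∧ NullMeasurableSet Ω volume ∧ 0 < volume Ω ∧ volume Ω < ∞ ∧
      flatPiece x A Ω ⊆ E ∧ T = flatAverage E x A Ω

/-- The constant `sup_r sup {‖ω‖₀ / ‖ω‖_{𝒯⁽ʳ⁾} : ω ∈ 𝒱⁽ʳ⁾ \ {0}}` of a mesh. -/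
def meshConstant {E : Set (Vec n)} (𝒱 : ℕ+ → Submodule ℝ (TestForm E k))
    (𝒯 : ℕ+ → Set (TestForm E k → ℝ)) : ℝ≥0∞ :=
  ⨆ r, ⨆ ω ∈ {ω | ω ∈ 𝒱 r ∧ ω ≠ 0}, zeroNorm ω / seminormOn (𝒯 r) ω

/-- `𝒱`-admissible integral `k`-meshes for `E`. -/
def IsAdmissibleMesh (E : Set (Vec n)) (k : ℕ) (𝒱 : ℕ+ → Submodule ℝ (TestForm E k))
    (𝒯 : ℕ+ → Set (TestForm E k → ℝ)) : Prop :=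
  IsIntegralMesh E k 𝒯 ∧
  limsup (fun r : ℕ+ => ((𝒯 r).ncard : ℝ≥0∞) ^ (1 / (r : ℝ))) atTop ≤ 1 ∧
  meshConstant 𝒱 𝒯 < ∞

/-- The space `𝒫_r Λ^k(E)` of restrictions to `E` of the `k`-forms whose coefficients are
polynomials of total degree at most `r`. -/
def polyForms (E : Set (Vec n)) (k : ℕ) (r : ℕ+) : Submodule ℝ (TestForm E k) where
  carrier := {ω | ∀ α : MultiIdx n k, ∃ p ∈ MvPolynomial.restrictTotalDegree (Fin n) ℝ (r : ℕ),
    ∀ x : E, coeff (ω x) α = MvPolynomial.eval (fun i => (x : Vec n) i) p}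
  zero_mem' := fun _ => ⟨0, Submodule.zero_mem _, fun _ => by simp [coeff]⟩
  add_mem' := by
    intro ω η hω hη α
    obtain ⟨p, hp, hpe⟩ := hω α
    obtain ⟨q, hq, hqe⟩ := hη α
    refine ⟨p + q, Submodule.add_mem _ hp hq, fun x => ?_⟩
    rw [map_add, ← hpe, ← hqe]
    simp [coeff]
  smul_mem' := by
    intro c ω hω α
    obtain ⟨p, hp, hpe⟩ := hω α
    refine ⟨c • p, Submodule.smul_mem _ c hp, fun x => ?_⟩
    rw [MvPolynomial.smul_eval, ← hpe]
    simp [coeff]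

/-! ### The construction on a convex body -/

/-- The width of `E`, i.e. the minimal distance of two parallel supporting hyperplanes. -/
def width (E : Set (Vec n)) : ℝ :=
  sInf {ℓ : ℝ | ∃ v : Vec n, ‖v‖ = 1 ∧ ∀ x ∈ E, ∀ y ∈ E, inner ℝ (x - y) v ≤ ℓ}

/-- The side length `d = c₁ w(E) / (4 √n C(n,k) r²)`. -/
def sideBound (E : Set (Vec n)) (k : ℕ) (c₁ : ℝ) (r : ℕ+) : ℝ :=
  c₁ * width E / (4 * √(n : ℝ) * (n.choose k : ℝ) * (r : ℝ) ^ 2)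

/-- The closed coordinate box `∏ⱼ [aⱼ, bⱼ]`. -/
def coordBox (a b : Vec n) : Set (Vec n) := {x | ∀ j, a j ≤ x j ∧ x j ≤ b j}

/-- The closed coordinate cube `∏ⱼ [qⱼ, qⱼ + ℓ]`. -/
def coordCube (q : Vec n) (ℓ : ℝ) : Set (Vec n) := {x | ∀ j, q j ≤ x j ∧ x j ≤ q j + ℓ}

/-- The simplex `Σ_k = {y ∈ ℝ^k : yᵢ ≥ 0, ∑ yᵢ ≤ 1}`. -/
def unitSimplex (k : ℕ) : Set (Vec k) := {y | (∀ i, 0 ≤ y i) ∧ ∑ i, y i ≤ 1}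

/-- The matrix `P^α` with columns `e_{α(1)}, …, e_{α(k)}`. -/
def coordMatrix (α : MultiIdx n k) : Matrix (Fin n) (Fin k) ℝ :=
  Matrix.of fun i j => if i = α j then 1 else 0

/-- The choices made at level `r`: a tessellation of a bounding box of `E` by coordinate cubes
`Q_i` whose sides lie between `κ d` and `d`, where `d` is `sideBound`; for each cube that meets
the interior of `E`, a point of `Q_i ∩ int E`; and for each such cube and each multi-index `α`,
a size `ε > 0` at most the distances of that point from `∂E` and from `∂Q_i`. -/
structure CubeChoice (E : Set (Vec n)) (k : ℕ) (c₁ κ : ℝ) (r : ℕ+) where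
  /-- lower corner of the bounding box -/
  lo : Vec n
  /-- upper corner of the bounding box -/
  hi : Vec n
  /-- number of cubes -/
  num : ℕ
  /-- lower corners of the cubes -/
  corner : Fin num → Vec n
  /-- sides of the cubes -/
  side : Fin num → ℝ
  /-- points of the cubes -/
  pt : Fin num → Vec n
  /-- sizes of the simplices -/
  eps : Fin num → MultiIdx n k → ℝ
  subset_box : E ⊆ coordBox lo hi
  iUnion_cubes : ⋃ i, coordCube (corner i) (side i) = coordBox lo hi
  disjoint_cubes : Pairwise fun i j =>
    Disjoint (interior (coordCube (corner i) (side i))) (interior (coordCube (corner j) (side j)))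
  le_side : ∀ i, κ * sideBound E k c₁ r ≤ side i
  side_le : ∀ i, side i ≤ sideBound E k c₁ r
  pt_mem : ∀ i, (coordCube (corner i) (side i) ∩ interior E).Nonempty →
    pt i ∈ coordCube (corner i) (side i) ∩ interior E
  eps_spec : ∀ i, (coordCube (corner i) (side i) ∩ interior E).Nonempty → ∀ α,
    0 < eps i α ∧ eps i α ≤ Metric.infDist (pt i) (frontier E) ∧
    eps i α ≤ Metric.infDist (pt i) (frontier (coordCube (corner i) (side i)))

/-- The set `𝒯⁽ʳ⁾` of averaging functionals over the simplices `x + P^α (ε Σ_k)`, one for each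
cube that meets the interior of `E` and each multi-index `α`. -/
def CubeChoice.mesh {E : Set (Vec n)} {c₁ κ : ℝ} {r : ℕ+} (D : CubeChoice E k c₁ κ r) :
    Set (TestForm E k → ℝ) :=
  {T | ∃ (i : Fin D.num) (α : MultiIdx n k),
    (coordCube (D.corner i) (D.side i) ∩ interior E).Nonempty ∧
    T = flatAverage E (D.pt i) (coordMatrix α) ((fun y => D.eps i α • y) '' unitSimplex k)}

end

end FormMesh

namespace FormMesh

/-! ### Markov's inequality at an endpoint, in one variable. -/

section Markov

open Polynomial

/-! A polynomial of degree at most `r`, bounded by `M` on a convex body `E`, has gradient at most `4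
r² M / w(E)` there: restrict it to chords from `x`, apply the Chebyshev endpoint bound `2 r² M` to
each, and note that a gradient of norm `g` confines `E` to a slab of thickness `4 r² M / g`, which
cannot be less than the width (`width_mul_norm_fderiv_le`).

Let `M` be the largest absolute value on `E` of any coefficient of `ω`, attained at `x₀` by the
coefficient `α`. A cube of side at most `d` has diameter at most `√n d`, so on the part of `E` in
the cube of `x₀` this coefficient varies by at most `c₁ M`. The simplex of that cube in direction
`α` is oriented by `e_α`, so its functional averages exactly that coefficient and has absolute value
at least `(1 - c₁) M` (`CubeChoice.exists_mem_mesh_le`). Conversely, Cauchy–Schwarz against a unit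
`k`-vector gives `‖ω‖₀ ≤ √(n choose k) M` (`zeroNorm_le`). Dividing yields the norm comparison.

The cardinality is a volume count: the cubes that meet `int E` have disjoint interiors, sides at
least `κ d`, and lie in a cube of side comparable to `diam E`. As `d` is a constant times `w(E) /
r²`, this gives `(diam E / w(E))^n r^(2n)`, whose `r`-th root has limit `1` (`card_cubes_le`,
`limsup_rpow_one_div_le_one`). -/

theorem derivative_chebyshevT_eval_one (r : ℕ) :
    (derivative (Chebyshev.T ℝ r)).eval 1 = (r : ℝ) ^ 2 := by
  rw [Chebyshev.T_derivative_eq_U]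
  simp [Chebyshev.U_eval_one]
  ring

/-- Markov's inequality at an endpoint of the unit interval. -/
theorem abs_eval_derivative_zero_le {P : ℝ[X]} {r : ℕ} {M : ℝ} (hdeg : P.natDegree ≤ r)
    (hP : ∀ t ∈ Set.Icc (0 : ℝ) 1, |P.eval t| ≤ M) :
    |(derivative P).eval 0| ≤ 2 * (r : ℝ) ^ 2 * M := by
  have hM : 0 ≤ M := (abs_nonneg _).trans (hP 0 (by simp))
  -- Normalizing by `M` needs `M ≠ 0`; when `M = 0`, `P` has infinitely many roots.
  rcases hM.eq_or_lt with rfl | hM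
  · have h0 : P = 0 := by
      refine eq_zero_of_infinite_isRoot P ((Set.Icc_infinite (zero_lt_one' ℝ)).mono fun t ht => ?_)
      exact abs_eq_zero.1 (le_antisymm (hP t ht) (abs_nonneg _))
    simp [h0]
  -- The substitution `t = (1 - s) / 2` carries `[-1, 1]` to `[0, 1]` and `s = 1` to `t = 0`, at the
  -- cost of a factor `-1/2` in the derivative. The Chebyshev comparison is one-sided, so both signs
  -- `c = ± 1/M` are needed.
  have key : ∀ c : ℝ, |c| = M⁻¹ → -(c / 2) * (derivative P).eval 0 ≤ (r : ℝ) ^ 2 := by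
    intro c hc
    have h := Chebyshev.eval_iterate_derivative_le_of_forall_abs_le_one (n := r) (k := 1)
      (x := 1) (P := C c * P.comp (C (1 / 2) - C (1 / 2) * X)) le_rfl ?_ ?_
    · rw [Function.iterate_one, derivative_chebyshevT_eval_one] at h
      refine le_trans (le_of_eq ?_) h
      simp [derivative_comp]
      ring
    · refine degree_le_of_natDegree_le ?_
      refine (natDegree_C_mul_le _ _).trans (natDegree_comp_le.trans ?_)
      refine (Nat.mul_le_mul hdeg ?_).trans (mul_one r).le
      refine (natDegree_sub_le _ _).trans (max_le (by simp) ?_)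
      exact (natDegree_C_mul_le _ _).trans natDegree_X_le
    · intro t ht
      simp only [eval_mul, eval_C, eval_comp, eval_sub, eval_X, abs_mul, hc]
      rw [inv_mul_le_iff₀ hM, mul_one]
      exact hP _ ⟨by linarith [ht.2], by linarith [ht.1]⟩
  have h1 := key M⁻¹ (abs_of_pos (inv_pos.2 hM))
  have h2 := key (-M⁻¹) (by rw [abs_neg, abs_of_pos (inv_pos.2 hM)])
  have e : ∀ d : ℝ, d = 2 * M * ((M⁻¹ / 2) * d) := fun d => by field_simp
  rw [abs_le]
  constructor
  · rw [e (eval 0 (derivative P))]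
    nlinarith
  · rw [e (eval 0 (derivative P))]
    nlinarith

end Markov

/-! ### Markov's inequality for polynomials on a convex body. -/

variable {n k : ℕ}

theorem contDiff_mvPolynomial_eval (p : MvPolynomial (Fin n) ℝ) :
    ContDiff ℝ 1 fun x : Vec n => MvPolynomial.eval (fun i => x i) p := by
  induction p using MvPolynomial.induction_on with
  | C a => simpa using contDiff_const
  | add p q hp hq => simpa using hp.add hq
  | mul_X p i hp =>
    simp only [map_mul, MvPolynomial.eval_X]
    exact hp.mul (by fun_prop)

/-- Markov's inequality along a chord. -/
theorem abs_fderiv_sub_le {E : Set (Vec n)} (hE : Convex ℝ E) {p : MvPolynomial (Fin n) ℝ}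
    {r : ℕ} (hp : p.totalDegree ≤ r) {M : ℝ}
    (hM : ∀ x ∈ E, |MvPolynomial.eval (fun i => x i) p| ≤ M) {x a : Vec n} (hx : x ∈ E)
    (ha : a ∈ E) :
    |fderiv ℝ (fun x : Vec n => MvPolynomial.eval (fun i => x i) p) x (a - x)|
      ≤ 2 * (r : ℝ) ^ 2 * M := by
  set f : Vec n → ℝ := fun x => MvPolynomial.eval (fun i => x i) p with hf
  -- `P` is `p` along the chord, `t ↦ p (x + t (a - x))`: substituting polynomials of degree at most
  -- `1` keeps the degree at most `r`, and convexity keeps `[0, 1]` inside `E`.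
  set P : Polynomial ℝ := MvPolynomial.aeval
    (fun i => Polynomial.C (x i) + Polynomial.C (a i - x i) * Polynomial.X) p with hPdef
  have hev : ∀ t : ℝ, P.eval t = f (x + t • (a - x)) := by
    intro t
    have := MvPolynomial.map_aeval (fun i => Polynomial.C (x i) + Polynomial.C (a i - x i) *
      Polynomial.X) (Polynomial.evalRingHom t) p
    rw [Polynomial.coe_evalRingHom] at this
    rw [hPdef, this, hf]
    simp only [MvPolynomial.eval, MvPolynomial.coe_eval₂Hom]
    congr 1
    · ext; simp
    · ext i; simp; ring
  have hdeg : P.natDegree ≤ r := by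
    refine (MvPolynomial.aeval_natDegree_le p hp _ (n := 1) fun i => ?_).trans (mul_one r).le
    rw [add_comm]
    exact Polynomial.natDegree_linear_le
  have hder : (Polynomial.derivative P).eval 0 = fderiv ℝ f x (a - x) := by
    have h1 := P.hasDerivAt 0
    have h2 : HasDerivAt (fun t : ℝ => f (x + t • (a - x))) (fderiv ℝ f x (a - x)) 0 := by
      have hd : HasFDerivAt f (fderiv ℝ f x) (x + (0 : ℝ) • (a - x)) := by
        simpa using ((contDiff_mvPolynomial_eval p).differentiable (by simp) x).hasFDerivAt
      have hl : HasDerivAt (fun t : ℝ => x + t • (a - x)) (a - x) 0 := by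
        simpa using ((hasDerivAt_id (0 : ℝ)).smul_const (a - x)).const_add x
      exact hd.comp_hasDerivAt 0 hl
    refine h1.unique (h2.congr_of_eventuallyEq (Eventually.of_forall fun t => hev t))
  rw [← hder]
  refine abs_eval_derivative_zero_le hdeg fun t ht => ?_
  rw [hev]
  exact hM _ (hE.add_smul_sub_mem hx ha ht)

theorem width_le {E : Set (Vec n)} (hne : E.Nonempty) {v : Vec n} (hv : ‖v‖ = 1) {ℓ : ℝ}
    (h : ∀ x ∈ E, ∀ y ∈ E, inner ℝ (x - y) v ≤ ℓ) : width E ≤ ℓ := by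
  obtain ⟨x, hx⟩ := hne
  refine csInf_le ⟨0, ?_⟩ ⟨v, hv, h⟩
  -- Pairing a point with itself shows that every competitor is nonnegative, so the infimum is over
  -- a set bounded below.
  rintro ℓ ⟨v, -, hv⟩
  simpa using hv x hx x hx

/-- The multivariate Markov inequality on a convex body of positive width. -/
theorem width_mul_norm_fderiv_le {E : Set (Vec n)} (hE : Convex ℝ E)
    {p : MvPolynomial (Fin n) ℝ} {r : ℕ} (hp : p.totalDegree ≤ r) {M : ℝ}
    (hM : ∀ x ∈ E, |MvPolynomial.eval (fun i => x i) p| ≤ M) {x : Vec n} (hx : x ∈ E) :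
    width E * ‖fderiv ℝ (fun x : Vec n => MvPolynomial.eval (fun i => x i) p) x‖
      ≤ 4 * (r : ℝ) ^ 2 * M := by
  set g := fderiv ℝ (fun x : Vec n => MvPolynomial.eval (fun i => x i) p) x with hg
  have hM0 : 0 ≤ M := (abs_nonneg _).trans (hM x hx)
  rcases eq_or_ne g 0 with h0 | h0
  · rw [h0, norm_zero, mul_zero]; positivity
  have hg0 : 0 < ‖g‖ := norm_pos_iff.2 h0
  rw [← le_div_iff₀ hg0]
  set u := (InnerProductSpace.toDual ℝ (Vec n)).symm g with hu
  have hun : ‖u‖ = ‖g‖ := by simp [hu]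
  -- Test the width in the gradient direction. The two chords from `x` to `y` and to `z` contribute
  -- `2 r² M` each.
  refine width_le ⟨x, hx⟩ (v := ‖g‖⁻¹ • u) (by rw [norm_smul, hun]; simp [hg0.ne']) ?_
  intro y hy z hz
  have e : inner ℝ (y - z) (‖g‖⁻¹ • u) = (g (y - x) - g (z - x)) / ‖g‖ := by
    rw [inner_smul_right, real_inner_comm, hu, InnerProductSpace.toDual_symm_apply, ← map_sub,
      sub_sub_sub_cancel_right, div_eq_inv_mul]
  rw [e]
  gcongr
  have h1 := (abs_le.1 (abs_fderiv_sub_le hE hp hM hx hy)).2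
  have h2 := (abs_le.1 (abs_fderiv_sub_le hE hp hM hx hz)).1
  rw [← hg] at h1 h2
  linarith

theorem abs_eval_sub_eval_le {E : Set (Vec n)} (hE : Convex ℝ E) (hw : 0 < width E)
    {p : MvPolynomial (Fin n) ℝ} {r : ℕ} (hp : p.totalDegree ≤ r) {M : ℝ}
    (hM : ∀ x ∈ E, |MvPolynomial.eval (fun i => x i) p| ≤ M) {x y : Vec n} (hx : x ∈ E)
    (hy : y ∈ E) :
    |MvPolynomial.eval (fun i => y i) p - MvPolynomial.eval (fun i => x i) p|
      ≤ 4 * (r : ℝ) ^ 2 * M / width E * ‖y - x‖ := by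
  refine hE.norm_image_sub_le_of_norm_hasFDerivWithin_le
    (f := fun x : Vec n => MvPolynomial.eval (fun i => x i) p)
    (fun z _ => ((contDiff_mvPolynomial_eval p).differentiable
      (by simp) z).hasFDerivAt.hasFDerivWithinAt) (fun z hz => ?_) hx hy
  rw [le_div_iff₀ hw, mul_comm]
  exact width_mul_norm_fderiv_le hE hp hM hz

/-! ### Width, distances to boundaries and cubes -/

theorem width_pos {E : Set (Vec n)} (hn : 1 ≤ n) (hE : Bornology.IsBounded E)
    (hint : (interior E).Nonempty) : 0 < width E := by
  obtain ⟨x, hx⟩ := hint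
  obtain ⟨ρ, hρ, hball⟩ := Metric.nhds_basis_closedBall.mem_iff.1 (mem_interior_iff_mem_nhds.1 hx)
  refine lt_of_lt_of_le (show 0 < 2 * ρ by positivity) (le_csInf ?_ ?_)
  -- The infimum of an empty set would be `0` by convention; the first axis, which exists as `n ≥
  -- 1`, supplies a competitor.
  · refine ⟨Metric.diam E, EuclideanSpace.single ⟨0, hn⟩ 1, by simp, fun y hy z hz => ?_⟩
    refine (real_inner_le_norm _ _).trans ?_
    simpa [← dist_eq_norm] using Metric.dist_le_diam_of_mem hE hy hz
  · rintro ℓ ⟨v, hv, h⟩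
    have h1 := h (x + ρ • v) (hball (by simp [norm_smul, hv, abs_of_pos hρ])) (x - ρ • v)
      (hball (by simp [norm_smul, hv, abs_of_pos hρ]))
    have e : x + ρ • v - (x - ρ • v) = (2 * ρ) • v := by module
    rw [e, inner_smul_left, real_inner_self_eq_norm_sq, hv] at h1
    simpa using h1

theorem width_le_diam {E : Set (Vec n)} (hn : 1 ≤ n) (hE : Bornology.IsBounded E)
    (hne : E.Nonempty) : width E ≤ Metric.diam E := by
  refine width_le hne (v := EuclideanSpace.single ⟨0, hn⟩ 1) (by simp) fun y hy z hz => ?_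
  refine (real_inner_le_norm _ _).trans ?_
  simpa [← dist_eq_norm] using Metric.dist_le_diam_of_mem hE hy hz

theorem sideBound_pos {E : Set (Vec n)} (hn : 1 ≤ n) (hk : k ≤ n) {c₁ : ℝ} (hc : 0 < c₁)
    (hw : 0 < width E) (r : ℕ+) : 0 < sideBound E k c₁ r := by
  have h1 : 0 < n.choose k := Nat.choose_pos hk
  have h2 : 0 < (r : ℕ) := r.pos
  unfold sideBound
  positivity

theorem sideBound_le_width {E : Set (Vec n)} (hn : 1 ≤ n) (hk : k ≤ n) {c₁ : ℝ} (hc : c₁ ≤ 1)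
    (hw : 0 ≤ width E) (r : ℕ+) : sideBound E k c₁ r ≤ width E := by
  have h1 : (1 : ℝ) ≤ n.choose k := by exact_mod_cast Nat.choose_pos hk
  have h2 : (1 : ℝ) ≤ (r : ℝ) := by exact_mod_cast r.pos
  have h3 : (1 : ℝ) ≤ √(n : ℝ) := Real.one_le_sqrt.2 (by exact_mod_cast hn)
  unfold sideBound
  have h4 : (1 : ℝ) ≤ 4 * √(n : ℝ) * (n.choose k : ℝ) * (r : ℝ) ^ 2 := by
    have := one_le_mul_of_one_le_of_one_le (one_le_mul_of_one_le_of_one_le h3 h1)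
      (one_le_pow₀ h2 (n := 2))
    nlinarith
  rw [div_le_iff₀ (by linarith)]
  nlinarith

/-- The open ball is connected and misses the frontier, so it cannot leave the interior of `A`;
closedness of `A` then gives the closed ball. -/
theorem closedBall_subset_of_le_infDist_frontier {A : Set (Vec n)} (hA : IsClosed A) {x : Vec n}
    (hx : x ∈ A) {ε : ℝ} (hε : 0 < ε) (h : ε ≤ Metric.infDist x (frontier A)) :
    Metric.closedBall x ε ⊆ A := by
  rw [← closure_ball x hε.ne']
  refine hA.closure_subset_iff.2 ?_
  have hfr : ∀ z ∈ Metric.ball x ε, z ∉ frontier A := fun z hz hzA => by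
    have := Metric.infDist_le_dist_of_mem (x := x) hzA
    rw [Metric.mem_ball, dist_comm] at hz
    linarith
  have hcov : Metric.ball x ε ⊆ interior A ∪ Aᶜ := fun z hz => by
    by_contra hz'
    rw [Set.mem_union, not_or, Set.notMem_compl_iff] at hz'
    exact hfr z hz ⟨subset_closure hz'.2, hz'.1⟩
  have hxi : x ∈ interior A :=
    (hcov (Metric.mem_ball_self hε)).resolve_right (Set.notMem_compl_iff.2 hx)
  refine ((convex_ball x ε).isPreconnected.subset_left_of_subset_union isOpen_interior
    hA.isOpen_compl ?_ hcov ⟨x, Metric.mem_ball_self hε, hxi⟩).trans interior_subset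
  exact Set.disjoint_compl_right_iff_subset.2 interior_subset

theorem infDist_frontier_pos {A : Set (Vec n)} (hn : 1 ≤ n) (hA : Bornology.IsBounded A)
    {x : Vec n} (hx : x ∈ interior A) : 0 < Metric.infDist x (frontier A) := by
  have : Nonempty (Fin n) := ⟨⟨0, hn⟩⟩
  -- `infDist` to an empty set is `0` by convention, so the frontier must be shown nonempty: a
  -- bounded set is not the whole space.
  have hfr : (frontier A).Nonempty := by
    rw [nonempty_frontier_iff]
    refine ⟨⟨x, interior_subset hx⟩, fun h => ?_⟩
    exact NormedSpace.unbounded_univ ℝ (Vec n) (h ▸ hA)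
  refine (isClosed_frontier.notMem_iff_infDist_pos hfr).1 fun h => h.2 hx

theorem isClosed_coordCube (q : Vec n) (ℓ : ℝ) : IsClosed (coordCube q ℓ) := by
  simp only [coordCube, Set.ofPred_forall, Set.ofPred_and]
  exact isClosed_iInter fun j => (isClosed_le (by fun_prop) (by fun_prop)).inter
    (isClosed_le (by fun_prop) (by fun_prop))

theorem convex_coordCube (q : Vec n) (ℓ : ℝ) : Convex ℝ (coordCube q ℓ) := by
  intro x hx y hy a b ha hb hab j
  have h := convex_Icc (q j) (q j + ℓ) (hx j) (hy j) ha hb hab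
  simpa using h

theorem isBounded_coordCube (q : Vec n) (ℓ : ℝ) : Bornology.IsBounded (coordCube q ℓ) := by
  have : coordCube q ℓ ⊆ WithLp.toLp 2 '' Set.Icc q.ofLp (fun j => q.ofLp j + ℓ) := fun x hx =>
    ⟨x.ofLp, ⟨fun j => (hx j).1, fun j => (hx j).2⟩, rfl⟩
  exact (isCompact_Icc.image (PiLp.continuous_toLp 2 _)).isBounded.subset this

theorem interior_coordCube (q : Vec n) (ℓ : ℝ) :
    interior (coordCube q ℓ) = {x | ∀ j, q j < x j ∧ x j < q j + ℓ} := by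
  have : coordCube q ℓ = EuclideanSpace.equiv (Fin n) ℝ ⁻¹'
      Set.pi Set.univ fun j => Set.Icc (q j) (q j + ℓ) := by
    ext x; simp only [coordCube, Set.mem_ofPred_eq, Set.mem_preimage, Set.mem_univ_pi, Set.mem_Icc]; rfl
  rw [this, ← ContinuousLinearEquiv.coe_toHomeomorph, ← Homeomorph.preimage_interior,
    interior_pi_set Set.finite_univ]
  ext x
  simp [interior_Icc]

theorem norm_sub_le_of_mem_coordCube {q : Vec n} {ℓ : ℝ} {x y : Vec n} (hx : x ∈ coordCube q ℓ)
    (hy : y ∈ coordCube q ℓ) (hℓ : 0 ≤ ℓ) : ‖y - x‖ ≤ √(n : ℝ) * ℓ := by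
  rw [EuclideanSpace.norm_eq]
  refine Real.sqrt_le_iff.2 ⟨by positivity, ?_⟩
  rw [mul_pow, Real.sq_sqrt (Nat.cast_nonneg n)]
  calc ∑ i, ‖(y - x) i‖ ^ 2 ≤ ∑ _i : Fin n, ℓ ^ 2 := by
        refine Finset.sum_le_sum fun i _ => ?_
        rw [Real.norm_eq_abs]
        refine pow_le_pow_left₀ (abs_nonneg _) (abs_le.2 ⟨?_, ?_⟩) 2
        · have := hx i; have := hy i; simp only [PiLp.sub_apply]; linarith
        · have := hx i; have := hy i; simp only [PiLp.sub_apply]; linarith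
    _ = n * ℓ ^ 2 := by simp

theorem interior_coordCube_inter_nonempty {q : Vec n} {ℓ : ℝ} (hℓ : 0 < ℓ) {U : Set (Vec n)}
    (hU : IsOpen U) (h : (coordCube q ℓ ∩ U).Nonempty) :
    (interior (coordCube q ℓ) ∩ U).Nonempty := by
  obtain ⟨x, hxQ, hxU⟩ := h
  have hint : (interior (coordCube q ℓ)).Nonempty := by
    rw [interior_coordCube]
    exact ⟨WithLp.toLp 2 fun j => q j + ℓ / 2, fun j => ⟨by simp [hℓ], by simp [hℓ]⟩⟩
  have hx : x ∈ closure (interior (coordCube q ℓ)) := by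
    rw [(convex_coordCube q ℓ).closure_interior_eq_closure_of_nonempty_interior hint]
    exact subset_closure hxQ
  obtain ⟨y, hyU, hy⟩ := mem_closure_iff.1 hx U hU hxU
  exact ⟨y, hy, hyU⟩

theorem volume_setOf_forall_lt (a b : Vec n) :
    volume {x : Vec n | ∀ j, a j < x j ∧ x j < b j} = ∏ j, ENNReal.ofReal (b j - a j) := by
  have : {x : Vec n | ∀ j, a j < x j ∧ x j < b j} =
      WithLp.ofLp ⁻¹' Set.pi Set.univ fun j => Set.Ioo (a j) (b j) := by
    ext x; simp
  rw [this, (PiLp.volume_preserving_ofLp (Fin n)).measure_preimage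
    (MeasurableSet.univ_pi fun _ => measurableSet_Ioo).nullMeasurableSet, volume_pi_pi]
  simp

theorem exists_grid_index {d t : ℝ} (hd : 0 < d) {N : ℕ} (hN : N ≠ 0) (h0 : 0 ≤ t)
    (h1 : t ≤ N * d) : ∃ m : Fin N, (m : ℝ) * d ≤ t ∧ t ≤ m * d + d := by
  rcases lt_or_ge ⌊t / d⌋₊ N with h | h
  · refine ⟨⟨_, h⟩, ?_, ?_⟩
    · rw [← le_div_iff₀ hd]; exact Nat.floor_le (by positivity)
    · have := (Nat.lt_floor_add_one (t / d)).le
      rw [div_le_iff₀ hd] at this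
      simpa [add_mul] using this
  -- Here `t` is the right endpoint `N d`, which is assigned to the last cell.
  · obtain ⟨N, rfl⟩ := Nat.exists_eq_succ_of_ne_zero hN
    refine ⟨⟨N, N.lt_succ_self⟩, ?_, ?_⟩
    · rw [← le_div_iff₀ hd]
      refine (?_ : (N : ℝ) ≤ (⌊t / d⌋₊ : ℝ)).trans (Nat.floor_le (by positivity))
      exact_mod_cast (Nat.le_succ N).trans h
    · simpa [add_mul] using h1

/-! ### Existence of the choices, by a uniform grid, and the packing bound. -/

theorem nonempty_cubeChoice {E : Set (Vec n)} (hn : 1 ≤ n) (hk : k ≤ n) {c₁ κ : ℝ} (hc : 0 < c₁)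
    (hκ : κ ≤ 1) (hE : IsCompact E) (hint : (interior E).Nonempty) (r : ℕ+) :
    Nonempty (CubeChoice E k c₁ κ r) := by
  classical
  have hw := width_pos hn hE.isBounded hint
  obtain ⟨d, hd⟩ : ∃ d, d = sideBound E k c₁ r := ⟨_, rfl⟩
  have hd0 : 0 < d := hd ▸ sideBound_pos hn hk hc hw r
  obtain ⟨R, hR⟩ := hE.isBounded.subset_closedBall (0 : Vec n)
  -- The `+ 1` keeps `N` nonzero, as `exists_grid_index` requires.
  obtain ⟨N, hN⟩ : ∃ N : ℕ, N = ⌈2 * R / d⌉₊ + 1 := ⟨_, rfl⟩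
  have hNd : 2 * R ≤ N * d := by
    rw [← div_le_iff₀ hd0, hN]
    push_cast
    linarith [Nat.le_ceil (2 * R / d)]
  let m : Fin (N ^ n) → Fin n → Fin N := finFunctionFinEquiv.symm
  let q : Fin (N ^ n) → Vec n := fun i => WithLp.toLp 2 fun j => -R + (m i j : ℝ) * d
  -- The point is taken in the interior of the cube as well, since a positive `eps` forces positive
  -- distance to both boundaries.
  have key : ∀ i, ∃ x : Vec n, (coordCube (q i) d ∩ interior E).Nonempty →
      x ∈ interior (coordCube (q i) d) ∩ interior E := by
    intro i
    by_cases h : (coordCube (q i) d ∩ interior E).Nonempty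
    · obtain ⟨x, hx⟩ := interior_coordCube_inter_nonempty hd0 isOpen_interior h
      exact ⟨x, fun _ => hx⟩
    · exact ⟨0, fun h' => (h h').elim⟩
  choose pt hpt using key
  exact ⟨{
    lo := WithLp.toLp 2 fun _ => -R
    hi := WithLp.toLp 2 fun _ => -R + N * d
    num := N ^ n
    corner := q
    side := fun _ => d
    pt := pt
    eps := fun i _ => min (Metric.infDist (pt i) (frontier E))
      (Metric.infDist (pt i) (frontier (coordCube (q i) d)))
    subset_box := by
      intro x hx j
      have h1 : |x j| ≤ R := (PiLp.norm_apply_le x j).trans (by simpa using hR hx)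
      rw [abs_le] at h1
      exact ⟨h1.1, by simp only; linarith [h1.2]⟩
    iUnion_cubes := by
      ext x
      simp only [Set.mem_iUnion, coordCube, coordBox, Set.mem_ofPred_eq, q]
      constructor
      · rintro ⟨i, hi⟩ j
        have h1 : ((m i j : ℕ) : ℝ) + 1 ≤ N := by exact_mod_cast (m i j).2
        have h2 : (0 : ℝ) ≤ (m i j : ℕ) * d := by positivity
        have h3 := hi j
        constructor <;> nlinarith
      · intro hx
        have := fun j => exists_grid_index (t := x j + R) hd0 (N := N) (by omega)
          (by linarith [(hx j).1]) (by linarith [(hx j).2])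
        choose f hf using this
        refine ⟨finFunctionFinEquiv f, fun j => ?_⟩
        simp only [m, Equiv.symm_apply_apply]
        constructor <;> linarith [(hf j).1, (hf j).2]
    disjoint_cubes := by
      intro i i' hii
      have hne : m i ≠ m i' := fun h => hii (finFunctionFinEquiv.symm.injective h)
      obtain ⟨j, hj⟩ := Function.ne_iff.1 hne
      rw [interior_coordCube, interior_coordCube, Set.disjoint_left]
      intro x hx hx'
      have h1 := hx j
      have h2 := hx' j
      simp only [q] at h1 h2
      rcases lt_or_gt_of_ne hj with h | h
      · have : ((m i j : ℕ) : ℝ) + 1 ≤ (m i' j : ℕ) := by exact_mod_cast h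
        nlinarith
      · have : ((m i' j : ℕ) : ℝ) + 1 ≤ (m i j : ℕ) := by exact_mod_cast h
        nlinarith
    le_side := fun _ => by rw [← hd]; nlinarith
    side_le := fun _ => hd.le
    pt_mem := fun i h => ⟨interior_subset (hpt i h).1, (hpt i h).2⟩
    eps_spec := fun i h _ => ⟨lt_min (infDist_frontier_pos hn hE.isBounded (hpt i h).2)
      (infDist_frontier_pos hn (isBounded_coordCube _ _) (hpt i h).1), min_le_left _ _,
      min_le_right _ _⟩ }⟩

/-- A packing bound for the cubes of a tessellation that meet the interior of `E`. -/
theorem card_cubes_le {E : Set (Vec n)} (hn : 1 ≤ n) (hk : k ≤ n) {c₁ κ : ℝ} (hc : 0 < c₁)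
    (hc₁ : c₁ ≤ 1) (hκ : 0 < κ) (hE : IsCompact E) (hint : (interior E).Nonempty) {r : ℕ+}
    (D : CubeChoice E k c₁ κ r) (s : Finset (Fin D.num))
    (hs : ∀ i ∈ s, (coordCube (D.corner i) (D.side i) ∩ interior E).Nonempty) :
    (s.card : ℝ) ≤ (4 * Metric.diam E / (κ * sideBound E k c₁ r)) ^ n := by
  have hw := width_pos hn hE.isBounded hint
  have hd0 := sideBound_pos hn hk hc hw r
  have hdw := (sideBound_le_width hn hk hc₁ hw.le r).trans
    (width_le_diam hn hE.isBounded (hint.mono interior_subset))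
  set d := sideBound E k c₁ r
  set δ := Metric.diam E
  obtain ⟨x, hx⟩ := hint
  have hκd : 0 < κ * d := by positivity
  have h2δ : 0 ≤ 2 * (δ + d) := by linarith
  have hvol : (s.card : ℝ≥0∞) * ENNReal.ofReal (κ * d) ^ n ≤
      ENNReal.ofReal (2 * (δ + d)) ^ n := by
    calc (s.card : ℝ≥0∞) * ENNReal.ofReal (κ * d) ^ n
        = ∑ _i ∈ s, ENNReal.ofReal (κ * d) ^ n := by simp
      _ ≤ ∑ i ∈ s, volume (interior (coordCube (D.corner i) (D.side i))) := by
          refine Finset.sum_le_sum fun i _ => ?_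
          have := volume_setOf_forall_lt (D.corner i)
            (WithLp.toLp 2 fun j => D.corner i j + D.side i)
          simp only [add_sub_cancel_left, Finset.prod_const, Finset.card_univ,
            Fintype.card_fin] at this
          rw [interior_coordCube, this]
          gcongr
          exact D.le_side i
      _ = volume (⋃ i ∈ s, interior (coordCube (D.corner i) (D.side i))) :=
          (measure_biUnion_finset (fun i _ j _ hij => D.disjoint_cubes hij)
            fun i _ => isOpen_interior.measurableSet).symm
      -- A cube that meets `E` has a point within `δ` of `x`, and its side is at most `d`.
      _ ≤ volume {y : Vec n | ∀ j, (WithLp.toLp 2 fun j => x j - (δ + d) : Vec n) j < y j ∧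
            y j < (WithLp.toLp 2 fun j => x j + (δ + d) : Vec n) j} := by
          refine measure_mono (Set.iUnion₂_subset fun i hi y hy j => ?_)
          obtain ⟨z, hzQ, hzE⟩ := hs i hi
          rw [interior_coordCube] at hy
          have h1 := hzQ j
          have h2 := hy j
          have h3 := D.side_le i
          have h4 : |z j - x j| ≤ δ := by
            refine (PiLp.norm_apply_le (z - x) j).trans ?_
            rw [← dist_eq_norm]
            exact Metric.dist_le_diam_of_mem hE.isBounded (interior_subset hzE)
              (interior_subset hx)
          rw [abs_le] at h4
          constructor <;> simp only <;> linarith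
      _ = ENNReal.ofReal (2 * (δ + d)) ^ n := by
          rw [volume_setOf_forall_lt]
          simp only [add_sub_sub_cancel, Finset.prod_const, Finset.card_univ, Fintype.card_fin]
          congr 2
          ring
  rw [← ENNReal.ofReal_natCast, ← ENNReal.ofReal_pow hκd.le, ← ENNReal.ofReal_pow h2δ,
    ← ENNReal.ofReal_mul (Nat.cast_nonneg _),
    ENNReal.ofReal_le_ofReal_iff (pow_nonneg h2δ n)] at hvol
  rw [div_pow, le_div_iff₀ (pow_pos hκd n)]
  refine hvol.trans (pow_le_pow_left₀ h2δ ?_ n)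
  -- `d ≤ w(E) ≤ δ` turns `2 (δ + d)` into `4 δ`.
  linarith

/-! ### Coordinate simplices -/

/-- The affine embedding `y ↦ x + P^α y`. -/
noncomputable def coordMap (x : Vec n) (α : MultiIdx n k) (y : Vec k) : Vec n :=
  x + WithLp.toLp 2 ((coordMatrix α).mulVec y.ofLp)

theorem flatPiece_coordMatrix (x : Vec n) (α : MultiIdx n k) (Ω : Set (Vec k)) :
    flatPiece x (coordMatrix α) Ω = coordMap x α '' Ω := rfl

theorem coordMatrix_mulVec_apply (α : MultiIdx n k) (y : Fin k → ℝ) (j : Fin k) :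
    (coordMatrix α).mulVec y (α j) = y j := by
  simp [coordMatrix, Matrix.mulVec, dotProduct]

theorem coordMatrix_mulVec_of_notMem (α : MultiIdx n k) (y : Fin k → ℝ) {i : Fin n}
    (hi : i ∉ Set.range α) : (coordMatrix α).mulVec y i = 0 := by
  have : ∀ j, i ≠ α j := fun j h => hi ⟨j, h.symm⟩
  simp [coordMatrix, Matrix.mulVec, dotProduct, this]

theorem norm_coordMatrix_mulVec (α : MultiIdx n k) (y : Vec k) :
    ‖(WithLp.toLp 2 ((coordMatrix α).mulVec y.ofLp) : Vec n)‖ = ‖y‖ := by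
  rw [EuclideanSpace.norm_eq, EuclideanSpace.norm_eq]
  congr 1
  refine (Fintype.sum_of_injective α α.injective _ _ (fun i hi => ?_) fun j => ?_).symm
  · simp [coordMatrix_mulVec_of_notMem α _ hi]
  · simp [coordMatrix_mulVec_apply]

theorem isometry_coordMap (x : Vec n) (α : MultiIdx n k) : Isometry (coordMap x α) := by
  refine Isometry.of_dist_eq fun y z => ?_
  rw [dist_eq_norm, dist_eq_norm, coordMap, coordMap, add_sub_add_left_eq_sub, ← WithLp.toLp_sub,
    ← Matrix.mulVec_sub, ← WithLp.ofLp_sub, norm_coordMatrix_mulVec]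

theorem rank_coordMatrix (α : MultiIdx n k) : (coordMatrix α).rank = k := by
  have h : (coordMatrix α).transpose * coordMatrix α = 1 := by
    ext i j
    simp [coordMatrix, Matrix.mul_apply, Matrix.one_apply, eq_comm]
  rw [← Matrix.rank_transpose_mul_self, h, Matrix.rank_one, Fintype.card_fin]

theorem toLp_col_coordMatrix (α : MultiIdx n k) (j : Fin k) :
    (WithLp.toLp 2 ((coordMatrix α).col j) : Vec n) = EuclideanSpace.single (α j) 1 := by
  ext i
  simp [coordMatrix]

/-- The minor of `P^α` in rows `α` is that of the identity. For `β ≠ α` some row of the minor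
vanishes, because an increasing multi-index is determined by its range and the two ranges have the
same size. -/
theorem wedge_coordMatrix (α : MultiIdx n k) :
    (wedge fun j => WithLp.toLp 2 ((coordMatrix α).col j)) = EuclideanSpace.single α (1 : ℝ) := by
  ext β
  simp only [wedge, coordMatrix, Matrix.col_apply, Matrix.of_apply, PiLp.single_apply]
  split_ifs with h
  · subst h
    convert Matrix.det_one (n := Fin k) (R := ℝ) using 2
    ext i j
    simp [Matrix.one_apply]
  · obtain ⟨i, hi⟩ : ∃ i, β i ∉ Set.range α := by
      by_contra! hsub
      have hle : Finset.univ.image β ⊆ Finset.univ.image α := by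
        intro i hi
        simp only [Finset.mem_image, Finset.mem_univ, true_and] at hi ⊢
        obtain ⟨j, rfl⟩ := hi
        exact hsub j
      have heq := Finset.eq_of_subset_of_card_le hle (by
        rw [Finset.card_image_of_injective _ α.injective,
          Finset.card_image_of_injective _ β.injective])
      have hr : Set.range β = Set.range α := by
        simpa using congrArg (fun s : Finset (Fin n) => (s : Set (Fin n))) heq
      exact h (DFunLike.coe_injective ((β.strictMono.range_inj α.strictMono).1 hr))
    refine Matrix.det_eq_zero_of_row_eq_zero i fun j => ?_
    simp only [Matrix.of_apply]
    exact if_neg fun hj => hi ⟨j, hj.symm⟩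

theorem flatOrientation_coordMatrix (α : MultiIdx n k) :
    flatOrientation (coordMatrix α) = EuclideanSpace.single α (1 : ℝ) := by
  rw [flatOrientation, wedge_coordMatrix]
  simp

theorem pairing_single (η : KCovec n k) (α : MultiIdx n k) :
    pairing η (EuclideanSpace.single α (1 : ℝ)) = coeff η α := by
  simp [pairing]

/-- Orthogonal projection to `Wᗮ`, read in an orthonormal basis. It supplies the defining equations
that exhibit a plane as a regular level set. -/
theorem exists_continuousLinearMap_ker_eq (W : Submodule ℝ (Vec n)) :
    ∃ (m : ℕ) (A : Vec n →L[ℝ] Vec m), m + Module.finrank ℝ W = n ∧ Function.Surjective A ∧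
      LinearMap.ker (A : Vec n →ₗ[ℝ] Vec m) = W := by
  refine ⟨Module.finrank ℝ Wᗮ, ((stdOrthonormalBasis ℝ Wᗮ).repr.toContinuousLinearEquiv :
    Wᗮ →L[ℝ] _).comp Wᗮ.orthogonalProjectionOnto, ?_, ?_, ?_⟩
  · rw [add_comm, W.finrank_add_finrank_orthogonal, finrank_euclideanSpace, Fintype.card_fin]
  · refine (stdOrthonormalBasis ℝ Wᗮ).repr.surjective.comp fun w => ⟨w, ?_⟩
    simp
  · ext x
    simp

/-- A flat piece of a coordinate plane is oriented by the corresponding basis `k`-vector. -/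
theorem isOrientation_single {S : Set (Vec n)} {x : Vec n} {α : MultiIdx n k}
    (hS : S ⊆ Set.range (coordMap x α)) (hm : NullMeasurableSet S μHE[k]) :
    IsOrientation S fun _ => EuclideanSpace.single α (1 : ℝ) := by
  set v : Fin k → Vec n := fun j => WithLp.toLp 2 ((coordMatrix α).col j) with hv
  have hli : LinearIndependent ℝ v := by
    have := ((EuclideanSpace.basisFun (Fin n) ℝ).orthonormal.comp α α.injective).linearIndependent
    have e : v = EuclideanSpace.basisFun (Fin n) ℝ ∘ α := by
      ext j : 1
      simp [hv, toLp_col_coordMatrix]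
    rw [e]
    exact this
  obtain ⟨m, A, hmn, hsurj, hker⟩ :=
    exists_continuousLinearMap_ker_eq (Submodule.span ℝ (Set.range v))
  rw [finrank_span_eq_card hli, Fintype.card_fin] at hmn
  set N : Set (Vec n) := {y | A (y - x) = 0} with hN
  have hder : ∀ y, HasFDerivAt (fun y => A (y - x)) A y := fun y =>
    A.hasFDerivAt.comp y ((hasFDerivAt_id y).sub_const x)
  have hmfd : ∀ y ∈ N, IsC1SubmanifoldAt k N y (Submodule.span ℝ (Set.range v)) := by
    intro y _
    refine ⟨m, fun y => A (y - x), Set.univ, hmn, isOpen_univ, Set.mem_univ _, ?_, ?_, ?_, ?_⟩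
    · exact (A.contDiff.comp (contDiff_id.sub contDiff_const)).contDiffOn
    · intro y _
      rwa [(hder y).fderiv]
    · simp [hN]
    · rw [(hder y).fderiv, hker]
  have hSN : S ⊆ N := by
    intro y hy
    obtain ⟨z, rfl⟩ := hS hy
    have hz : coordMap x α z - x ∈ Submodule.span ℝ (Set.range v) := by
      have e : coordMap x α z - x = ∑ j, z j • v j := by
        ext i
        simp [coordMap, hv, Matrix.mulVec, dotProduct, mul_comm]
      rw [e]
      exact Submodule.sum_mem _ fun j _ => Submodule.smul_mem _ _ (Submodule.subset_span ⟨j, rfl⟩)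
    rw [← hker] at hz
    exact hz
  -- One piece suffices; the rest of the required sequence is padded with empty sets.
  have hU : (⋃ i : ℕ, if i = 0 then S else ∅) = S := by
    refine subset_antisymm (Set.iUnion_subset fun i => ?_) fun y hy => Set.mem_iUnion.2 ⟨0, by simpa⟩
    split_ifs <;> simp
  refine ⟨fun _ => N, fun i => if i = 0 then S else ∅, ∅, ?_, by simp, by simp, ?_, ?_, ?_,
    continuousOn_const⟩
  · rw [hU, Set.union_empty]
  · intro i j hij
    rcases eq_or_ne i 0 with rfl | hi
    · simp [hij.symm]
    · simp [hi]
  · intro i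
    refine ⟨fun y hy => ⟨_, hmfd y hy⟩, ?_, ?_⟩
    · dsimp only
      split_ifs
      exacts [hSN, Set.empty_subset _]
    · dsimp only
      split_ifs
      exacts [hm, nullMeasurableSet_empty]
  · intro i y hy
    have hyS : y ∈ S := hU ▸ Set.mem_iUnion.2 ⟨i, hy⟩
    refine ⟨_, hmfd y (hSN hyS), by simp, v, Or.inl ?_, hli, rfl⟩
    rw [hv, wedge_coordMatrix]

theorem isCompact_unitSimplex (k : ℕ) : IsCompact (unitSimplex k) := by
  refine Metric.isCompact_of_isClosed_isBounded ?_ ?_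
  · simp only [unitSimplex, Set.ofPred_and, Set.ofPred_forall]
    exact (isClosed_iInter fun j => isClosed_le (by fun_prop) (by fun_prop)).inter
      (isClosed_le (by fun_prop) (by fun_prop))
  · refine (isBounded_coordCube (0 : Vec k) 1).subset fun y hy j => ⟨by simpa using hy.1 j, ?_⟩
    have := Finset.single_le_sum (f := fun i => y i) (fun i _ => hy.1 i) (Finset.mem_univ j)
    simpa using this.trans hy.2

theorem norm_le_one_of_mem_unitSimplex {y : Vec k} (hy : y ∈ unitSimplex k) : ‖y‖ ≤ 1 := by
  rw [EuclideanSpace.norm_eq]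
  refine Real.sqrt_le_one.2 (le_trans (Finset.sum_le_sum fun i _ => ?_) hy.2)
  have h0 := hy.1 i
  have h1 : y i ≤ 1 :=
    (Finset.single_le_sum (f := fun i => y i) (fun i _ => hy.1 i) (Finset.mem_univ i)).trans hy.2
  rw [Real.norm_eq_abs, sq_abs]
  nlinarith

theorem isCompact_smul_unitSimplex (k : ℕ) (ε : ℝ) :
    IsCompact ((fun y => ε • y) '' unitSimplex k) :=
  (isCompact_unitSimplex k).image (continuous_const_smul ε)

theorem volume_smul_unitSimplex_pos (k : ℕ) {ε : ℝ} (hε : 0 < ε) :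
    0 < volume ((fun y => ε • y) '' unitSimplex k) := by
  have hk : (0 : ℝ) < k + 1 := by positivity
  -- An open cube of side `ε / (k + 1)` fits in the simplex; `k + 1` in place of `k` also covers `k
  -- = 0`.
  have hsub : {y : Vec k | ∀ j, (0 : Vec k) j < y j ∧
      y j < (WithLp.toLp 2 fun _ => ε / (k + 1) : Vec k) j} ⊆
      (fun y => ε • y) '' unitSimplex k := by
    intro y hy
    refine ⟨ε⁻¹ • y, ⟨fun j => ?_, ?_⟩, by simp [smul_smul, hε.ne']⟩
    · have := (hy j).1.le
      simp only [PiLp.zero_apply] at this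
      simp only [PiLp.smul_apply, smul_eq_mul]
      positivity
    · calc ∑ i, (ε⁻¹ • y) i ≤ ∑ _i : Fin k, ((k : ℝ) + 1)⁻¹ := by
            refine Finset.sum_le_sum fun i _ => ?_
            have := (hy i).2.le
            simp only [PiLp.smul_apply, smul_eq_mul]
            rw [inv_mul_le_iff₀ hε]
            exact this
        _ ≤ 1 := by
            simp only [Finset.sum_const, Finset.card_univ, Fintype.card_fin, nsmul_eq_mul]
            rw [← div_eq_mul_inv, div_le_one hk]
            linarith
  refine lt_of_lt_of_le ?_ (measure_mono hsub)
  rw [volume_setOf_forall_lt]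
  refine CanonicallyOrderedAdd.prod_pos.2 fun j _ => ?_
  simp only [PiLp.zero_apply, sub_zero, ENNReal.ofReal_pos]
  positivity

theorem euclideanHausdorffMeasure_coordMap_image (x : Vec n) (α : MultiIdx n k)
    (Ω : Set (Vec k)) : μHE[k] (coordMap x α '' Ω) = volume Ω := by
  rw [(isometry_coordMap x α).euclideanHausdorffMeasure_image,
    EuclideanSpace.euclideanHausdorffMeasure_eq_volume]

theorem flatAverage_mem_averagingCurrents {E : Set (Vec n)} {x : Vec n} {α : MultiIdx n k}
    {Ω : Set (Vec k)} (hΩ : IsCompact Ω) (hpos : 0 < volume Ω)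
    (hsub : flatPiece x (coordMatrix α) Ω ⊆ E) :
    flatAverage E x (coordMatrix α) Ω ∈ averagingCurrents E k := by
  have hm : NullMeasurableSet (flatPiece x (coordMatrix α) Ω) μHE[k] := by
    rw [flatPiece_coordMatrix]
    exact (hΩ.image (isometry_coordMap x α).continuous).isClosed.measurableSet.nullMeasurableSet
  refine ⟨flatPiece x (coordMatrix α) Ω, fun _ => flatOrientation (coordMatrix α), hsub, hm,
    ?_, ?_, ?_, ?_, rfl⟩
  · rwa [flatPiece_coordMatrix, euclideanHausdorffMeasure_coordMap_image]
  · rw [flatPiece_coordMatrix, euclideanHausdorffMeasure_coordMap_image]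
    exact hΩ.measure_lt_top
  · refine ⟨∅, fun _ => coordMap x α, by simp, fun _ => ⟨1, (isometry_coordMap x α).lipschitz⟩, ?_⟩
    rw [flatPiece_coordMatrix]
    refine (Set.image_subset_range _ _).trans ?_
    exact (Set.subset_iUnion (fun _ : ℕ => Set.range (coordMap x α)) 0).trans
      Set.subset_union_right
  · rw [flatOrientation_coordMatrix]
    exact isOrientation_single (Set.image_subset_range (coordMap x α) _) hm

theorem continuous_coeff (α : MultiIdx n k) : Continuous fun η : KCovec n k => coeff η α :=
  (ContinuousAlternatingMap.apply ℝ (Vec n) ℝ fun i => EuclideanSpace.single (α i) 1).continuous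

theorem continuousOn_coeff_extendZero {E : Set (Vec n)} (ω : TestForm E k) (α : MultiIdx n k) :
    ContinuousOn (fun x => coeff (extendZero ω x) α) E := by
  rw [continuousOn_iff_continuous_domRestrict]
  refine ((continuous_coeff α).comp ω.continuous).congr fun x => ?_
  simp [extendZero]

/-- The average over a coordinate piece is close to any number that the coefficient is close to
on that piece. -/
theorem abs_flatAverage_sub_le {E : Set (Vec n)} {x : Vec n} {α : MultiIdx n k}
    {Ω : Set (Vec k)} (hΩ : IsCompact Ω) (hpos : 0 < volume Ω)
    (hsub : flatPiece x (coordMatrix α) Ω ⊆ E) (ω : TestForm E k) {c δ : ℝ}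
    (h : ∀ y ∈ flatPiece x (coordMatrix α) Ω, |coeff (extendZero ω y) α - c| ≤ δ) :
    |flatAverage E x (coordMatrix α) Ω ω - c| ≤ δ := by
  set S := flatPiece x (coordMatrix α) Ω with hS
  have hμ : μHE[k] S = volume Ω := by
    rw [hS, flatPiece_coordMatrix, euclideanHausdorffMeasure_coordMap_image]
  have hμtop : μHE[k] S < ∞ := hμ ▸ hΩ.measure_lt_top
  have hScomp : IsCompact S := hΩ.image (isometry_coordMap x α).continuous
  have hμ0 : 0 < (μHE[k] S).toReal := ENNReal.toReal_pos (hμ ▸ hpos.ne') hμtop.ne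
  have hfin : IsFiniteMeasure ((μHE[k] : Measure (Vec n)).restrict S) :=
    ⟨by rwa [Measure.restrict_apply_univ]⟩
  have hint : IntegrableOn (fun y => coeff (extendZero ω y) α) S μHE[k] := by
    have hcont := (continuousOn_coeff_extendZero ω α).mono hsub
    obtain ⟨C, hC⟩ := hScomp.exists_bound_of_continuousOn hcont
    exact Integrable.of_bound (hcont.aestronglyMeasurable hScomp.measurableSet) C
      (ae_restrict_of_forall_mem hScomp.measurableSet hC)
  -- The orientation is `e_α`, so the pairing is the `α`-coefficient, and the constant `c` is its
  -- own average.
  have e : flatAverage E x (coordMatrix α) Ω ω - c =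
      (μHE[k] S).toReal⁻¹ * ∫ y in S, (coeff (extendZero ω y) α - c) ∂μHE[k] := by
    rw [integral_sub hint (integrable_const c), flatAverage, average,
      flatOrientation_coordMatrix, integral_const, measureReal_restrict_apply_univ]
    simp only [pairing_single, smul_eq_mul, Measure.real]
    rw [mul_sub, inv_mul_cancel_left₀ hμ0.ne']
  rw [e, abs_mul, abs_of_pos (inv_pos.2 hμ0), inv_mul_le_iff₀ hμ0, mul_comm]
  exact norm_setIntegral_le_of_norm_le_const hμtop fun y hy => (Real.norm_eq_abs _).trans_le (h y hy)

/-! ### The upper bound for `‖ω‖₀` -/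

theorem card_multiIdx (n k : ℕ) : Fintype.card (MultiIdx n k) = n.choose k := by
  rw [Fintype.card_eq_nat_card, Nat.card_congr Set.powersetCard.ofFinEmbEquiv,
    Set.powersetCard.card, Nat.card_fin]

/-- Bound the pairing by `M` times the `ℓ¹` norm of `τ`, then use Cauchy–Schwarz over the `n choose
k` coordinates. This is the origin of the square root in the final constant. -/
theorem abs_pairing_le {η : KCovec n k} {τ : KVec n k} {M : ℝ} (hη : ∀ α, |coeff η α| ≤ M)
    (hM : 0 ≤ M) : |pairing η τ| ≤ √(n.choose k : ℝ) * M * ‖τ‖ := by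
  have h1 : |pairing η τ| ≤ (∑ α, |τ α|) * M := by
    rw [pairing, Finset.sum_mul]
    refine (Finset.abs_sum_le_sum_abs _ _).trans (Finset.sum_le_sum fun α _ => ?_)
    rw [abs_mul]
    exact mul_le_mul_of_nonneg_left (hη α) (abs_nonneg _)
  have h2 : ∑ α, |τ α| ≤ √(n.choose k : ℝ) * ‖τ‖ := by
    rw [EuclideanSpace.norm_eq, ← Real.sqrt_mul (Nat.cast_nonneg _)]
    refine Real.le_sqrt_of_sq_le (sq_sum_le_card_mul_sum_sq.trans ?_)
    rw [Finset.card_univ, card_multiIdx]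
    simp
  calc |pairing η τ| ≤ (∑ α, |τ α|) * M := h1
    _ ≤ √(n.choose k : ℝ) * ‖τ‖ * M := mul_le_mul_of_nonneg_right h2 hM
    _ = √(n.choose k : ℝ) * M * ‖τ‖ := by ring

theorem zeroNorm_le {E : Set (Vec n)} {ω : TestForm E k} {M : ℝ} (hM : 0 ≤ M)
    (h : ∀ x ∈ E, ∀ α, |coeff (extendZero ω x) α| ≤ M) :
    zeroNorm ω ≤ ENNReal.ofReal (√(n.choose k : ℝ) * M) := by
  refine iSup₂_le ?_
  rintro T ⟨S, τ, hSE, hm, hpos, hfin, -, ⟨N, P, Z, hS, -, hZ, -, -, hτ, -⟩, rfl⟩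
  refine ENNReal.ofReal_le_ofReal ?_
  have hμ0 : 0 < (μHE[k] S).toReal := ENNReal.toReal_pos hpos.ne' hfin.ne
  rw [average, abs_mul, abs_of_pos (inv_pos.2 hμ0), inv_mul_le_iff₀ hμ0, mul_comm,
    ← Real.norm_eq_abs]
  refine norm_setIntegral_le_of_norm_le_const_ae hfin ((ae_restrict_iff'₀ hm).2 ?_)
  -- Off the null singular part, `τ` is a unit `k`-vector.
  filter_upwards [compl_mem_ae_iff.2 hZ] with x hxZ hxS
  have hxS' := hxS
  rw [hS] at hxS'
  obtain ⟨i, hi⟩ := Set.mem_iUnion.1 (hxS'.resolve_right hxZ)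
  obtain ⟨W, -, hτ1, -⟩ := hτ i x hi
  simpa [hτ1] using abs_pairing_le (τ := τ x) (h x (hSE hxS)) hM

/-! ### The lower bound for the mesh seminorm -/

theorem exists_forall_abs_coeff_le {E : Set (Vec n)} (hk : k ≤ n) (hE : IsCompact E)
    (hne : E.Nonempty) (ω : TestForm E k) :
    ∃ x₀ ∈ E, ∃ α₀, ∀ x ∈ E, ∀ α,
      |coeff (extendZero ω x) α| ≤ |coeff (extendZero ω x₀) α₀| := by
  have : Nonempty (MultiIdx n k) := ⟨Fin.castLEOrderEmb hk⟩
  have hmax : ∀ α : MultiIdx n k, ∃ x₀ ∈ E, ∀ x ∈ E,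
      |coeff (extendZero ω x) α| ≤ |coeff (extendZero ω x₀) α| := fun α =>
    hE.exists_isMaxOn hne (continuousOn_coeff_extendZero ω α).abs
  choose y hyE hy using hmax
  obtain ⟨α₀, hα₀⟩ := Finite.exists_max fun α => |coeff (extendZero ω (y α)) α|
  exact ⟨y α₀, hyE α₀, α₀, fun x hx α => (hy α x hx).trans (hα₀ α)⟩

/-- A cube containing a boundary point of `E` may miss `int E`. But `E` lies in the closure of `int
E`, which is the finite union of the closures of the sets `Q_i ∩ int E`, so some cube does both. -/
theorem exists_cube_of_mem {E : Set (Vec n)} (hE : Convex ℝ E) (hint : (interior E).Nonempty)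
    {c₁ κ : ℝ} {r : ℕ+} (D : CubeChoice E k c₁ κ r) {x : Vec n} (hx : x ∈ E) :
    ∃ i, x ∈ coordCube (D.corner i) (D.side i) ∧
      (coordCube (D.corner i) (D.side i) ∩ interior E).Nonempty := by
  have hcov : interior E = ⋃ i, coordCube (D.corner i) (D.side i) ∩ interior E := by
    rw [← Set.iUnion_inter, D.iUnion_cubes,
      Set.inter_eq_right.2 (interior_subset.trans D.subset_box)]
  have hx' : x ∈ closure (interior E) := by
    rw [hE.closure_interior_eq_closure_of_nonempty_interior hint]
    exact subset_closure hx
  rw [hcov, closure_iUnion_of_finite] at hx'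
  obtain ⟨i, hi⟩ := Set.mem_iUnion.1 hx'
  refine ⟨i, ?_, closure_nonempty_iff.1 ⟨x, hi⟩⟩
  exact (isClosed_coordCube _ _).closure_subset_iff.2 Set.inter_subset_left hi

theorem flatPiece_subset_closedBall (x : Vec n) (α : MultiIdx n k) {ε : ℝ} (hε : 0 ≤ ε) :
    flatPiece x (coordMatrix α) ((fun y => ε • y) '' unitSimplex k) ⊆ Metric.closedBall x ε := by
  rintro _ ⟨_, ⟨y, hy, rfl⟩, rfl⟩
  rw [Metric.mem_closedBall, dist_eq_norm, add_sub_cancel_left, norm_coordMatrix_mulVec, norm_smul,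
    Real.norm_of_nonneg hε]
  exact mul_le_of_le_one_right hε (norm_le_one_of_mem_unitSimplex hy)

variable {E : Set (Vec n)} {c₁ κ : ℝ} {r : ℕ+}

theorem CubeChoice.flatPiece_subset (D : CubeChoice E k c₁ κ r) (hE : IsClosed E) {i : Fin D.num}
    (hi : (coordCube (D.corner i) (D.side i) ∩ interior E).Nonempty) (α : MultiIdx n k) :
    flatPiece (D.pt i) (coordMatrix α) ((fun y => D.eps i α • y) '' unitSimplex k) ⊆
      E ∩ coordCube (D.corner i) (D.side i) := by
  obtain ⟨hε, hεE, hεQ⟩ := D.eps_spec i hi α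
  have hpt := D.pt_mem i hi
  exact (flatPiece_subset_closedBall _ α hε.le).trans (Set.subset_inter
    (closedBall_subset_of_le_infDist_frontier hE (interior_subset hpt.2) hε hεE)
    (closedBall_subset_of_le_infDist_frontier (isClosed_coordCube _ _) hpt.1 hε hεQ))

/-- The simplex lies in `E` and in a cube containing the maximum point `x₀`, where Markov's
inequality keeps the coefficient within `c₁` times its maximum of its value at `x₀`; so does the
average. -/
theorem CubeChoice.exists_mem_mesh_le (D : CubeChoice E k c₁ κ r) (hn : 1 ≤ n) (hk : k ≤ n)
    (hc₀ : 0 < c₁) (hE : IsCompact E) (hconv : Convex ℝ E) (hint : (interior E).Nonempty)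
    {ω : TestForm E k} (hω : ω ∈ polyForms E k r) {x₀ : Vec n} (hx₀ : x₀ ∈ E) {α : MultiIdx n k}
    (hmax : ∀ x ∈ E, |coeff (extendZero ω x) α| ≤ |coeff (extendZero ω x₀) α|) :
    ∃ T ∈ D.mesh, (1 - c₁) * |coeff (extendZero ω x₀) α| ≤ |T ω| := by
  have hw := width_pos hn hE.isBounded hint
  obtain ⟨i, hx₀i, hi⟩ := exists_cube_of_mem hconv hint D hx₀
  have hsub := D.flatPiece_subset hE.isClosed hi α
  obtain ⟨p, hp, hpω⟩ := hω α
  rw [MvPolynomial.mem_restrictTotalDegree] at hp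
  have hco : ∀ x ∈ E, coeff (extendZero ω x) α = MvPolynomial.eval (fun i => x i) p := by
    intro x hx
    rw [extendZero, dif_pos hx]
    exact hpω ⟨x, hx⟩
  have hpM : ∀ x ∈ E, |MvPolynomial.eval (fun i => x i) p| ≤ |coeff (extendZero ω x₀) α| :=
    fun x hx => hco x hx ▸ hmax x hx
  refine ⟨_, ⟨i, α, hi, rfl⟩, ?_⟩
  have hε := (D.eps_spec i hi α).1
  have hkey := abs_flatAverage_sub_le (isCompact_smul_unitSimplex k (D.eps i α))
    (volume_smul_unitSimplex_pos k hε) (hsub.trans Set.inter_subset_left) ω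
    (c := coeff (extendZero ω x₀) α) (δ := c₁ * |coeff (extendZero ω x₀) α|) (by
      intro y hy
      obtain ⟨hyE, hyQ⟩ := hsub hy
      rw [hco y hyE]
      nth_rewrite 1 [hco x₀ hx₀]
      refine (abs_eval_sub_eval_le hconv hw hp hpM hx₀ hyE).trans ?_
      have hside : 0 ≤ D.side i := by
        have := hx₀i ⟨0, hn⟩
        linarith
      have hnorm := (norm_sub_le_of_mem_coordCube hx₀i hyQ hside).trans
        (mul_le_mul_of_nonneg_left (D.side_le i) (Real.sqrt_nonneg _))
      have hC : (1 : ℝ) ≤ n.choose k := by exact_mod_cast Nat.choose_pos hk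
      have hr : (0 : ℝ) < (r : ℝ) := by exact_mod_cast r.pos
      have hsn : 0 < √(n : ℝ) := Real.sqrt_pos.2 (by exact_mod_cast hn)
      refine (mul_le_mul_of_nonneg_left hnorm (by positivity)).trans ?_
      -- The definition of `d` cancels `4 r² √n / w(E)` exactly; the remaining division by `n choose
      -- k ≥ 1` is slack.
      have e : 4 * (r : ℝ) ^ 2 * |coeff (extendZero ω x₀) α| / width E *
          (√(n : ℝ) * sideBound E k c₁ r) =
          c₁ * |coeff (extendZero ω x₀) α| / n.choose k := by
        unfold sideBound
        field_simp
      rw [e]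
      exact div_le_self (by positivity) hC)
  have h1 := abs_sub_abs_le_abs_sub (coeff (extendZero ω x₀) α)
    (flatAverage E (D.pt i) (coordMatrix α) ((fun y => D.eps i α • y) '' unitSimplex k) ω)
  rw [abs_sub_comm] at h1
  linarith

theorem CubeChoice.zeroNorm_le_mesh (D : CubeChoice E k c₁ κ r) (hn : 1 ≤ n) (hk : k ≤ n)
    (hc₀ : 0 < c₁) (hc₁ : c₁ < 1) (hE : IsCompact E) (hconv : Convex ℝ E)
    (hint : (interior E).Nonempty) {ω : TestForm E k} (hω : ω ∈ polyForms E k r) :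
    zeroNorm ω ≤ ENNReal.ofReal (√(n.choose k : ℝ) / (1 - c₁)) * seminormOn D.mesh ω := by
  obtain ⟨x₀, hx₀, α, hmax⟩ := exists_forall_abs_coeff_le hk hE (hint.mono interior_subset) ω
  obtain ⟨T, hT, hle⟩ := D.exists_mem_mesh_le hn hk hc₀ hE hconv hint hω hx₀
    fun x hx => hmax x hx α
  have h1 : 0 < 1 - c₁ := sub_pos.2 hc₁
  calc zeroNorm ω ≤ ENNReal.ofReal (√(n.choose k : ℝ) * |coeff (extendZero ω x₀) α|) :=
        zeroNorm_le (abs_nonneg _) hmax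
    _ = ENNReal.ofReal (√(n.choose k : ℝ) / (1 - c₁)) *
        ENNReal.ofReal ((1 - c₁) * |coeff (extendZero ω x₀) α|) := by
        rw [← ENNReal.ofReal_mul (by positivity)]
        congr 1
        field_simp
    _ ≤ ENNReal.ofReal (√(n.choose k : ℝ) / (1 - c₁)) * seminormOn D.mesh ω := by
        gcongr
        exact (ENNReal.ofReal_le_ofReal hle).trans
          (le_iSup₂ (f := fun (T : TestForm E k → ℝ) (_ : T ∈ D.mesh) => ENNReal.ofReal |T ω|) T hT)

/-! ### The cardinality of the mesh -/

theorem CubeChoice.finite_mesh (D : CubeChoice E k c₁ κ r) : D.mesh.Finite := by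
  refine (Set.finite_range fun q : Fin D.num × MultiIdx n k => flatAverage E (D.pt q.1)
    (coordMatrix q.2) ((fun y => D.eps q.1 q.2 • y) '' unitSimplex k)).subset ?_
  rintro T ⟨i, α, -, rfl⟩
  exact ⟨(i, α), rfl⟩

theorem CubeChoice.ncard_mesh_le (D : CubeChoice E k c₁ κ r) (hn : 1 ≤ n) (hk : k ≤ n)
    (hc₀ : 0 < c₁) (hc₁ : c₁ ≤ 1) (hκ : 0 < κ) (hE : IsCompact E)
    (hint : (interior E).Nonempty) :
    (D.mesh.ncard : ℝ) ≤ n.choose k * (16 * √(n : ℝ) * n.choose k / (κ * c₁)) ^ n *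
      (Metric.diam E / width E) ^ n * (r : ℝ) ^ (2 * n) := by
  classical
  set s : Finset (Fin D.num) := Finset.univ.filter fun i =>
    (coordCube (D.corner i) (D.side i) ∩ interior E).Nonempty with hs
  -- One functional per pair of a cube and a multi-index; coincidences only lower the count.
  have hcard : D.mesh.ncard ≤ s.card * n.choose k := by
    rw [← card_multiIdx, ← Finset.card_univ, ← Finset.card_product]
    refine le_trans ?_ (Finset.card_image_le (f := fun q : Fin D.num × MultiIdx n k =>
      flatAverage E (D.pt q.1) (coordMatrix q.2)
        ((fun y => D.eps q.1 q.2 • y) '' unitSimplex k)))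
    rw [← Set.ncard_coe_finset]
    refine Set.ncard_le_ncard ?_ (Finset.finite_toSet _)
    rintro T ⟨i, α, hi, rfl⟩
    exact Finset.mem_coe.2 (Finset.mem_image.2 ⟨(i, α), by simpa [hs] using hi, rfl⟩)
  have hle := card_cubes_le hn hk hc₀ hc₁ hκ hE hint D s fun i hi => by simpa [hs] using hi
  have hw := width_pos hn hE.isBounded hint
  have hC : (0 : ℝ) < n.choose k := by exact_mod_cast Nat.choose_pos hk
  have hr : (0 : ℝ) < (r : ℝ) := by exact_mod_cast r.pos
  have hsn : 0 < √(n : ℝ) := Real.sqrt_pos.2 (by exact_mod_cast hn)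
  calc (D.mesh.ncard : ℝ) ≤ s.card * n.choose k := by exact_mod_cast hcard
    _ ≤ (4 * Metric.diam E / (κ * sideBound E k c₁ r)) ^ n * n.choose k := by gcongr
    -- `16` is the `4` of the packing bound times the `4` in the denominator of `d`.
    _ = (16 * √(n : ℝ) * n.choose k / (κ * c₁) * (Metric.diam E / width E) * (r : ℝ) ^ 2) ^ n *
          n.choose k := by
        congr 2
        unfold sideBound
        field_simp
        ring
    _ = _ := by
        rw [mul_pow, mul_pow, ← pow_mul]
        ring

/-! ### Subexponential growth and admissibility. -/

theorem limsup_rpow_one_div_le_one {f : ℕ+ → ℕ} {B : ℝ} {m : ℕ}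
    (h : ∀ r : ℕ+, (f r : ℝ) ≤ B * (r : ℝ) ^ m) :
    limsup (fun r : ℕ+ => (f r : ℝ≥0∞) ^ (1 / (r : ℝ))) atTop ≤ 1 := by
  -- Replacing `B` by `max B 1` makes the base positive, so that its `1/r`-th power tends to `1`.
  have hB : (0 : ℝ) < max B 1 := lt_max_of_lt_right one_pos
  have hcast : Tendsto (fun r : ℕ+ => ((r : ℕ) : ℝ)) atTop atTop :=
    PNat.tendsto_comp_val_iff.2 tendsto_natCast_atTop_atTop
  have hlim : Tendsto (fun r : ℕ+ => (max B 1 * (r : ℝ) ^ m) ^ (1 / (r : ℝ))) atTop (𝓝 1) := by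
    have h1 : Tendsto (fun r : ℕ+ => (max B 1) ^ (1 / (r : ℝ))) atTop (𝓝 1) := by
      have := (Real.continuousAt_const_rpow hB.ne' (b := 0)).tendsto.comp
        (tendsto_const_nhds.div_atTop hcast : Tendsto (fun r : ℕ+ => (1 : ℝ) / (r : ℝ)) _ _)
      simpa [Function.comp_def] using this
    have h2 : Tendsto (fun r : ℕ+ => ((r : ℝ) ^ (1 / (r : ℝ))) ^ m) atTop (𝓝 1) := by
      simpa using (tendsto_rpow_div.comp hcast).pow m
    refine Tendsto.congr (fun r => ?_) (by simpa only [mul_one] using h1.mul h2)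
    rw [Real.mul_rpow hB.le (by positivity), ← Real.rpow_natCast, ← Real.rpow_natCast,
      ← Real.rpow_mul (by positivity), ← Real.rpow_mul (by positivity), mul_comm (m : ℝ)]
  have hlim' := (ENNReal.continuous_ofReal.tendsto 1).comp hlim
  rw [ENNReal.ofReal_one] at hlim'
  rw [← hlim'.limsup_eq]
  refine limsup_le_limsup (Eventually.of_forall fun r => ?_)
  have e : (f r : ℝ≥0∞) ^ (1 / (r : ℝ)) = ENNReal.ofReal ((f r : ℝ) ^ (1 / (r : ℝ))) := by
    rw [← ENNReal.ofReal_rpow_of_nonneg (Nat.cast_nonneg _) (by positivity),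
      ENNReal.ofReal_natCast]
  refine e.trans_le ?_
  refine ENNReal.ofReal_le_ofReal (Real.rpow_le_rpow (Nat.cast_nonneg _) ((h r).trans ?_)
    (by positivity))
  gcongr
  exact le_max_left _ _

theorem isAdmissibleMesh_mesh (hn : 1 ≤ n) (hk : k ≤ n) (hc₀ : 0 < c₁) (hc₁ : c₁ < 1)
    (hκ : 0 < κ) (hE : IsCompact E) (hconv : Convex ℝ E) (hint : (interior E).Nonempty)
    (D : ∀ r : ℕ+, CubeChoice E k c₁ κ r) :
    IsAdmissibleMesh E k (polyForms E k) fun r => (D r).mesh := by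
  refine ⟨fun r => ⟨(D r).finite_mesh, ?_, ?_⟩,
    limsup_rpow_one_div_le_one fun r => (D r).ncard_mesh_le hn hk hc₀ hc₁.le hκ hE hint, ?_⟩
  · rintro T ⟨i, α, hi, rfl⟩
    exact flatAverage_mem_averagingCurrents (isCompact_smul_unitSimplex k _)
      (volume_smul_unitSimplex_pos k ((D r).eps_spec i hi α).1)
      (((D r).flatPiece_subset hE.isClosed hi α).trans Set.inter_subset_left)
  · rintro T ⟨i, α, hi, rfl⟩
    have hΩ := isCompact_smul_unitSimplex k ((D r).eps i α)
    exact ⟨_, _, _, interior_subset ((D r).pt_mem i hi).2, rank_coordMatrix α,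
      hΩ.measurableSet.nullMeasurableSet,
      volume_smul_unitSimplex_pos k ((D r).eps_spec i hi α).1, hΩ.measure_lt_top,
      ((D r).flatPiece_subset hE.isClosed hi α).trans Set.inter_subset_left, rfl⟩
  · refine lt_of_le_of_lt (iSup_le fun r => iSup₂_le fun ω hω => ?_)
      (ENNReal.ofReal_lt_top (r := √(n.choose k : ℝ) / (1 - c₁)))
    -- A vanishing mesh seminorm does no harm: the norm comparison then forces `‖ω‖₀ = 0`, and `0 /
    -- 0 = 0` here.
    exact ENNReal.div_le_of_le_mul
      ((D r).zeroNorm_le_mesh hn hk hc₀ hc₁ hE hconv hint hω.1)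

end FormMesh

theorem mainTheorem7 (n k : ℕ) (hn : 1 ≤ n) (hk : k ≤ n) (c₁ κ : ℝ) (hc₀ : 0 < c₁) (hc₁ : c₁ < 1)
    (hκ₀ : 0 < κ) (hκ₁ : κ ≤ 1) :
    ∃ K : ℝ, ∀ E : Set (FormMesh.Vec n), IsCompact E → Convex ℝ E → (interior E).Nonempty →
      (∀ r : ℕ+, Nonempty (FormMesh.CubeChoice E k c₁ κ r)) ∧
      ∀ D : ∀ r : ℕ+, FormMesh.CubeChoice E k c₁ κ r,
        FormMesh.IsAdmissibleMesh E k (FormMesh.polyForms E k) (fun r => (D r).mesh) ∧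
        (∀ r : ℕ+, ∀ ω ∈ FormMesh.polyForms E k r,
          FormMesh.zeroNorm ω ≤
            ENNReal.ofReal (√(n.choose k : ℝ) / (1 - c₁)) *
              FormMesh.seminormOn (D r).mesh ω) ∧
        ∀ r : ℕ+, ((D r).mesh.ncard : ℝ) ≤
          K * (Metric.diam E / FormMesh.width E) ^ n * (r : ℝ) ^ (2 * n) := by
  -- The constant is fixed before `E`, so the cardinality bound is uniform over all convex bodies.
  refine ⟨n.choose k * (16 * √(n : ℝ) * n.choose k / (κ * c₁)) ^ n, fun E hE hconv hint =>
    ⟨fun r => FormMesh.nonempty_cubeChoice hn hk hc₀ hκ₁ hE hint r, fun D =>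
      ⟨FormMesh.isAdmissibleMesh_mesh hn hk hc₀ hc₁ hκ₀ hE hconv hint D,
        fun r ω hω => (D r).zeroNorm_le_mesh hn hk hc₀ hc₁ hE hconv hint hω,
        fun r => (D r).ncard_mesh_le hn hk hc₀ hc₁.le hκ₀ hE hint⟩⟩⟩
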